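/- **Proposition 3.3.** Let $\mathrm{O}(4,1;\mathbb{Z})$ be the group of matrices $g\in \mathrm{GL}_5(\mathbb{Z})$ with ${}^t g\,Q_0\,g=Q_0$, where $Q_0=\mathrm{diag}(1,1,1,1,-1)$, and for $N\ge 1$ let $\Gamma(N)=\{g\in \mathrm{O}(4,1;\mathbb{Z}) : g\equiv I \bmod N\}$ be its congruence subgroup of level $N$. For a group $G$ let $G_r^{(1)}$ denote the kernel of the natural homomorphism $G\to G^{ab}\otimes_{\mathbb{Z}}\mathbb{Q}$. A RFRS tower for a finitely generated group $G$ is a sequence of finite index subgroups $G=G_0\ge G_1\ge G_2\ge\cdots$ with $\bigcap_j G_j=\{1\}$ and $(G_j)_r^{(1)}\le G_{j+1}$ for all $j\ge 0$. The group $\Gamma(4)$ is finitely generated and admits a RFRS tower $\{\Gamma_j\}_{j\ge 0}$ such that for every $j$ there is an integer $n_j\ge 0$ with $\Gamma(2^{n_j})\le\Gamma_j$. -/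

import Mathlib

open scoped TensorProduct

/-- The natural homomorphism `G → G^ab ⊗ ℚ = H₁(G; ℚ)`. Its image is the rational
abelianization of `G`. -/
noncomputable def toRationalAbelianization (G : Type*) [Group G] :
    G →* Multiplicative (Additive (Abelianization G) ⊗[ℤ] ℚ) :=
  (AddMonoidHom.toMultiplicativeRight
    ((TensorProduct.mk ℤ (Additive (Abelianization G)) ℚ).flip 1).toAddMonoidHom).comp
    Abelianization.of

/-- The rational commutator subgroup of `G`: the kernel of `G → G^ab ⊗ ℚ`, equivalently the kernel
of the map from `G` onto its rational abelianization. -/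
noncomputable def rationalCommutator (G : Type*) [Group G] : Subgroup G :=
  (toRationalAbelianization G).ker

/-- A sequence `T 0, T 1, …` of subgroups is a RFRS tower for the finitely generated group `G`:
it starts at `G`, decreases, consists of finite index subgroups, has trivial intersection, and
the rational commutator subgroup of each term is contained in the next term. -/
structure IsRFRSTower {G : Type*} [Group G] (T : ℕ → Subgroup G) : Prop where
  fg : Group.FG G
  zero : T 0 = ⊤
  succ_le : ∀ j, T (j + 1) ≤ T j
  finiteIndex : ∀ j, (T j).FiniteIndex
  iInf_eq_bot : ⨅ j, T j = ⊥
  rationalCommutator_le : ∀ j, (rationalCommutator (T j)).map (T j).subtype ≤ T (j + 1)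

/-- The matrix `diag(1, 1, 1, 1, -1)`. -/
def lorentzMatrix : Matrix (Fin 5) (Fin 5) ℤ :=
  Matrix.diagonal ![1, 1, 1, 1, -1]

/-- `O(4,1;ℤ)`: the integral automorphisms of the quadratic form with matrix
`diag(1, 1, 1, 1, -1)`. -/
def integralLorentzGroup : Subgroup (GL (Fin 5) ℤ) where
  carrier := {g | (g : Matrix (Fin 5) (Fin 5) ℤ).transpose * lorentzMatrix *
    (g : Matrix (Fin 5) (Fin 5) ℤ) = lorentzMatrix}
  one_mem' := by simp
  mul_mem' := by
    intro a b ha hb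
    simp only [Set.mem_ofPred_eq] at ha hb ⊢
    calc _ = (b : Matrix (Fin 5) (Fin 5) ℤ).transpose *
          ((a : Matrix (Fin 5) (Fin 5) ℤ).transpose * lorentzMatrix * a.val) * b.val := by
            simp [Matrix.transpose_mul, Matrix.mul_assoc]
      _ = lorentzMatrix := by rw [ha, hb]
  inv_mem' := by
    intro a ha
    simp only [Set.mem_ofPred_eq] at ha ⊢
    have h1 : a.val * (a⁻¹).val = 1 := a.mul_inv
    have h2 : (a⁻¹).val.transpose * a.val.transpose = 1 := by
      rw [← Matrix.transpose_mul, h1, Matrix.transpose_one]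
    calc _ = (a⁻¹).val.transpose * (a.val.transpose * lorentzMatrix * a.val) * (a⁻¹).val := by
            rw [ha]
      _ = ((a⁻¹).val.transpose * a.val.transpose) * lorentzMatrix * (a.val * (a⁻¹).val) := by
            simp only [Matrix.mul_assoc]
      _ = lorentzMatrix := by rw [h1, h2, Matrix.one_mul, Matrix.mul_one]

/-- The level `N` congruence subgroup `Γ(N)` of `O(4,1;ℤ)`: the elements that are congruent to the
identity matrix modulo `N`. -/
def congruenceSubgroup (N : ℕ) : Subgroup integralLorentzGroup :=
  ((Matrix.GeneralLinearGroup.map (n := Fin 5) (Int.castRingHom (ZMod N))).comp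
    integralLorentzGroup.subtype).ker

/-! The tower is Γ(2^(j+2)). The point is that, for N = 2^(j+2), the rational commutator subgroup of
Γ(N) lies in Γ(2N).

Let W be `reflectionSubgroup`, generated by the reflections in the ten walls of a right-angled
hyperbolic polytope containing b = `basePoint`. A descent towards b shows that Γ(2) is generated by
W and -1; a mod 4 invariant that excludes -1 then gives Γ(4) ≤ W.

An element g of W is recorded by the signed crossings of a path from b to gb with the walls v⊥, v·v
= 1. If τ(v) is the simple root congruent to v mod 2, then gy - y is the sum over v of (crossing
number)·(τ(v)·y) v (`wallSum_eq`): both sides are cocycles on W and agree on the generators, because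
τ is Γ(2)-invariant.

Now group the walls by the class of v mod N. On Γ(N) with 4 ∣ N the crossing number of each class is
a homomorphism to ℤ, since Γ(N) preserves classes; hence it vanishes on the rational commutator
subgroup. The coefficient (τ(v)·y) v depends mod N only on the class, so the sum vanishes mod N.
Moreover v and -v contribute equally, and a representative of each pair can be chosen by a condition
mod 4. This gains the factor 2 (`mem_congruenceSubgroup_two_mul`). -/

/-! ### The Lorentzian form and the action on ℤ⁵ -/

/-- The Lorentzian form `x₀y₀ + x₁y₁ + x₂y₂ + x₃y₃ - x₄y₄` on `ℤ⁵`. -/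
def lorentzForm (x y : Fin 5 → ℤ) : ℤ :=
  x 0 * y 0 + x 1 * y 1 + x 2 * y 2 + x 3 * y 3 - x 4 * y 4

/-- The natural action of `O(4,1;ℤ)` on `ℤ⁵`. -/
def lorentzAct (g : integralLorentzGroup) : (Fin 5 → ℤ) →ₗ[ℤ] (Fin 5 → ℤ) :=
  Matrix.mulVecLin ((g : GL (Fin 5) ℤ) : Matrix (Fin 5) (Fin 5) ℤ)

theorem lorentzForm_eq_dotProduct (x y : Fin 5 → ℤ) :
    lorentzForm x y = x ⬝ᵥ (lorentzMatrix.mulVec y) := by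
  simp [lorentzForm, lorentzMatrix, dotProduct, Fin.sum_univ_five, Matrix.mulVec_diagonal]
  ring

theorem lorentzForm_comm (x y : Fin 5 → ℤ) : lorentzForm x y = lorentzForm y x := by
  simp only [lorentzForm]; ring

theorem lorentzForm_neg_left (x y : Fin 5 → ℤ) : lorentzForm (-x) y = -lorentzForm x y := by
  simp only [lorentzForm, Pi.neg_apply]; ring

@[simp] theorem lorentzAct_one (x : Fin 5 → ℤ) : lorentzAct 1 x = x := by
  simp [lorentzAct]

theorem lorentzAct_mul (g h : integralLorentzGroup) (x : Fin 5 → ℤ) :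
    lorentzAct (g * h) x = lorentzAct g (lorentzAct h x) := by
  simp [lorentzAct, Matrix.mulVec_mulVec]

@[simp] theorem lorentzAct_inv_apply (g : integralLorentzGroup) (x : Fin 5 → ℤ) :
    lorentzAct g⁻¹ (lorentzAct g x) = x := by
  rw [← lorentzAct_mul]; simp

@[simp] theorem lorentzAct_apply_inv (g : integralLorentzGroup) (x : Fin 5 → ℤ) :
    lorentzAct g (lorentzAct g⁻¹ x) = x := by
  rw [← lorentzAct_mul]; simp

theorem lorentzForm_act (g : integralLorentzGroup) (x y : Fin 5 → ℤ) :
    lorentzForm (lorentzAct g x) (lorentzAct g y) = lorentzForm x y := by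
  have h : ((g : GL (Fin 5) ℤ) : Matrix (Fin 5) (Fin 5) ℤ).transpose * lorentzMatrix *
    ((g : GL (Fin 5) ℤ) : Matrix (Fin 5) (Fin 5) ℤ) = lorentzMatrix := g.2
  rw [lorentzForm_eq_dotProduct, lorentzForm_eq_dotProduct]
  conv_rhs => rw [← h]
  simp only [lorentzAct, Matrix.mulVecLin_apply, ← Matrix.mulVec_mulVec]
  rw [Matrix.mulVec_transpose, dotProduct_comm x, ← Matrix.dotProduct_mulVec, dotProduct_comm]

theorem lorentzForm_inv_act (g : integralLorentzGroup) (x y : Fin 5 → ℤ) :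
    lorentzForm (lorentzAct g⁻¹ x) y = lorentzForm x (lorentzAct g y) := by
  rw [← lorentzForm_act g, lorentzAct_apply_inv]

theorem lorentzAct_single (g : integralLorentzGroup) (k i : Fin 5) :
    lorentzAct g (Pi.single k 1) i = ((g : GL (Fin 5) ℤ) : Matrix (Fin 5) (Fin 5) ℤ) i k := by
  simp [lorentzAct]

theorem lorentzAct_injective {g h : integralLorentzGroup}
    (H : ∀ x, lorentzAct g x = lorentzAct h x) : g = h := by
  apply Subtype.ext
  apply Units.ext
  ext i k
  rw [← lorentzAct_single, ← lorentzAct_single, H]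

theorem mem_congruenceSubgroup_iff {N : ℕ} {g : integralLorentzGroup} :
    g ∈ congruenceSubgroup N ↔ ∀ x i, (N : ℤ) ∣ lorentzAct g x i - x i := by
  have key : g ∈ congruenceSubgroup N ↔ ∀ i k,
      (N : ℤ) ∣ ((g : GL (Fin 5) ℤ) : Matrix (Fin 5) (Fin 5) ℤ) i k -
        (1 : Matrix (Fin 5) (Fin 5) ℤ) i k := by
    rw [congruenceSubgroup, MonoidHom.mem_ker, Units.ext_iff, ← Matrix.ext_iff]
    refine forall₂_congr fun i k => ?_
    rw [← ZMod.intCast_zmod_eq_zero_iff_dvd]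
    rcases eq_or_ne i k with rfl | h
    · simp [sub_eq_zero]
    · simp [h]
  rw [key]
  constructor
  · intro H x i
    have : lorentzAct g x i - x i = ∑ k, (((g : GL (Fin 5) ℤ) : Matrix (Fin 5) (Fin 5) ℤ) i k -
        (1 : Matrix (Fin 5) (Fin 5) ℤ) i k) * x k := by
      simp [lorentzAct, Matrix.mulVec, dotProduct, sub_mul, Finset.sum_sub_distrib,
        Matrix.one_apply]
    rw [this]
    exact Finset.dvd_sum fun k _ => (H i k).mul_right _
  · intro H i k
    have := H (Pi.single k 1) i
    rwa [lorentzAct_single, Pi.single_apply, ← Matrix.one_apply] at this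

theorem congruenceSubgroup_anti {M N : ℕ} (h : M ∣ N) :
    congruenceSubgroup N ≤ congruenceSubgroup M := fun _ hg =>
  mem_congruenceSubgroup_iff.2 fun x i =>
    (Int.natCast_dvd_natCast.2 h).trans (mem_congruenceSubgroup_iff.1 hg x i)

instance congruenceSubgroup_finiteIndex (N : ℕ) [NeZero N] :
    (congruenceSubgroup N).FiniteIndex := by
  unfold congruenceSubgroup
  infer_instance

/-! ### Reflections and -1 in Γ(2) -/

/-- The reflection `y ↦ y - 2 (n·y) n` as a matrix. -/
def reflectionMatrix (n : Fin 5 → ℤ) : Matrix (Fin 5) (Fin 5) ℤ :=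
  1 - (2 : ℤ) • Matrix.vecMulVec n (lorentzMatrix.mulVec n)

theorem reflectionMatrix_mulVec (n y : Fin 5 → ℤ) :
    (reflectionMatrix n).mulVec y = y - (2 * lorentzForm n y) • n := by
  rw [reflectionMatrix, Matrix.sub_mulVec, Matrix.one_mulVec, Matrix.smul_mulVec,
    Matrix.vecMulVec_mulVec, lorentzForm_comm, lorentzForm_eq_dotProduct, dotProduct_comm]
  ext i
  simp
  ring

theorem lorentzForm_reflection {n : Fin 5 → ℤ} (hn : lorentzForm n n = 1) (x y : Fin 5 → ℤ) :
    lorentzForm ((reflectionMatrix n).mulVec x) ((reflectionMatrix n).mulVec y) =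
      lorentzForm x y := by
  simp only [reflectionMatrix_mulVec]
  have : lorentzForm (x - (2 * lorentzForm n x) • n) (y - (2 * lorentzForm n y) • n) =
      lorentzForm x y + 4 * lorentzForm n x * lorentzForm n y * (lorentzForm n n - 1) := by
    simp only [lorentzForm, Pi.sub_apply, Pi.smul_apply, smul_eq_mul]
    ring
  rw [this, hn]; ring

theorem reflectionMatrix_mul_self {n : Fin 5 → ℤ} (hn : lorentzForm n n = 1) :
    reflectionMatrix n * reflectionMatrix n = 1 := by
  apply Matrix.ext_of_mulVec_single
  intro k
  rw [← Matrix.mulVec_mulVec, Matrix.one_mulVec]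
  generalize (Pi.single k 1 : Fin 5 → ℤ) = y
  have : lorentzForm n (y - (2 * lorentzForm n y) • n) = - lorentzForm n y := by
    have : lorentzForm n (y - (2 * lorentzForm n y) • n) =
      lorentzForm n y - 2 * lorentzForm n y * lorentzForm n n := by
      simp only [lorentzForm, Pi.sub_apply, Pi.smul_apply, smul_eq_mul]
      ring
    rw [this, hn]; ring
  rw [reflectionMatrix_mulVec, reflectionMatrix_mulVec, this]
  ext i
  simp

/-- The reflection in a vector of norm one, as an element of `O(4,1;ℤ)`. -/
def lorentzReflection (n : Fin 5 → ℤ) (hn : lorentzForm n n = 1) : integralLorentzGroup where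
  val := ⟨reflectionMatrix n, reflectionMatrix n, reflectionMatrix_mul_self hn,
    reflectionMatrix_mul_self hn⟩
  property := by
    change (reflectionMatrix n).transpose * lorentzMatrix * reflectionMatrix n = lorentzMatrix
    ext i k
    have h := lorentzForm_reflection hn (Pi.single i 1) (Pi.single k 1)
    rw [lorentzForm_eq_dotProduct, lorentzForm_eq_dotProduct, Matrix.mulVec_mulVec,
      dotProduct_comm, Matrix.dotProduct_mulVec, ← Matrix.mulVec_transpose, Matrix.mulVec_mulVec,
      dotProduct_comm, ← Matrix.mul_assoc] at h
    simpa using h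

theorem lorentzAct_reflection {n : Fin 5 → ℤ} (hn : lorentzForm n n = 1) (y : Fin 5 → ℤ) :
    lorentzAct (lorentzReflection n hn) y = y - (2 * lorentzForm n y) • n :=
  reflectionMatrix_mulVec n y

theorem lorentzReflection_mul_self {n : Fin 5 → ℤ} (hn : lorentzForm n n = 1) :
    lorentzReflection n hn * lorentzReflection n hn = 1 :=
  Subtype.ext (Units.ext (reflectionMatrix_mul_self hn))

theorem lorentzReflection_mem {n : Fin 5 → ℤ} (hn : lorentzForm n n = 1) :
    lorentzReflection n hn ∈ congruenceSubgroup 2 := by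
  rw [mem_congruenceSubgroup_iff]
  intro x i
  rw [lorentzAct_reflection]
  exact ⟨-(lorentzForm n x * n i), by simp; ring⟩

/-- Minus the identity, as an element of `O(4,1;ℤ)`. -/
def lorentzNegOne : integralLorentzGroup where
  val := -1
  property := by
    change ((-1 : GL (Fin 5) ℤ) : Matrix (Fin 5) (Fin 5) ℤ).transpose * lorentzMatrix *
      ((-1 : GL (Fin 5) ℤ) : Matrix (Fin 5) (Fin 5) ℤ) = lorentzMatrix
    simp

theorem lorentzAct_negOne_mul (g : integralLorentzGroup) (y : Fin 5 → ℤ) :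
    lorentzAct (lorentzNegOne * g) y = -lorentzAct g y := by
  rw [lorentzAct_mul]
  simp [lorentzAct, lorentzNegOne]

theorem lorentzNegOne_mem : lorentzNegOne ∈ congruenceSubgroup 2 := by
  rw [mem_congruenceSubgroup_iff]
  intro x i
  rw [← mul_one lorentzNegOne, lorentzAct_negOne_mul]
  exact ⟨-x i, by simp; ring⟩

/-! ### The right-angled polytope and generators of Γ(2) -/

/-- The inward normals of the walls of the right-angled polytope of `Γ(2)`. -/
def simpleRoot : Fin 10 → Fin 5 → ℤ :=
  ![![1, 0, 0, 0, 0], ![0, 1, 0, 0, 0], ![0, 0, 1, 0, 0], ![0, 0, 0, 1, 0],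
    ![-1, -1, 0, 0, -1], ![-1, 0, -1, 0, -1], ![-1, 0, 0, -1, -1],
    ![0, -1, -1, 0, -1], ![0, -1, 0, -1, -1], ![0, 0, -1, -1, -1]]

/-- An interior point of the right-angled polytope of `Γ(2)`. -/
def basePoint : Fin 5 → ℤ := ![1, 1, 1, 1, 3]

theorem lorentzForm_simpleRoot (a : Fin 10) : lorentzForm (simpleRoot a) (simpleRoot a) = 1 := by
  revert a; decide

theorem lorentzForm_simpleRoot_basePoint (a : Fin 10) :
    lorentzForm (simpleRoot a) basePoint = 1 := by
  revert a; decide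

/-- The reflection in a wall of the polytope. -/
def simpleReflection (a : Fin 10) : integralLorentzGroup :=
  lorentzReflection (simpleRoot a) (lorentzForm_simpleRoot a)

/-- The group generated by the reflections in the walls of the polytope. -/
def reflectionSubgroup : Subgroup integralLorentzGroup :=
  Subgroup.closure (Set.range simpleReflection)

theorem lorentzAct_simpleReflection (a : Fin 10) (y : Fin 5 → ℤ) :
    lorentzAct (simpleReflection a) y = y - (2 * lorentzForm (simpleRoot a) y) • simpleRoot a :=
  lorentzAct_reflection _ _

theorem simpleReflection_mem (a : Fin 10) : simpleReflection a ∈ reflectionSubgroup :=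
  Subgroup.subset_closure ⟨a, rfl⟩

theorem reflectionSubgroup_le : reflectionSubgroup ≤ congruenceSubgroup 2 := by
  rw [reflectionSubgroup, Subgroup.closure_le]
  rintro _ ⟨a, rfl⟩
  exact lorentzReflection_mem _

theorem eq_basePoint_of_forall_pos {x : Fin 5 → ℤ} (hx : lorentzForm x x = -5)
    (h : ∀ a, 0 < lorentzForm (simpleRoot a) x) : x = basePoint := by
  have h0 := h 0
  have h1 := h 1
  have h2 := h 2
  have h3 := h 3
  have h4 := h 4
  have h5 := h 5
  have h6 := h 6
  have h7 := h 7
  have h8 := h 8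
  have h9 := h 9
  simp [lorentzForm, simpleRoot] at hx h0 h1 h2 h3 h4 h5 h6 h7 h8 h9
  -- Here a, b are the two largest coordinates. From t ≥ a + b + 1 and c² + d² ≤ 2ab, the norm
  -- equation gives 2(a + b) + 1 ≤ 5.
  have key : ∀ a b c d t : ℤ, 0 < a → 0 < b → 0 < c → 0 < d → a + b < t →
      a * a + b * b + c * c + d * d - t * t = -5 → c ≤ a ∧ c ≤ b ∧ d ≤ a ∧ d ≤ b →
      a = 1 ∧ b = 1 ∧ c = 1 ∧ d = 1 ∧ t = 3 := by
    rintro a b c d t ha hb hc hd ht hq ⟨hca, hcb, hda, hdb⟩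
    have e1 : (a + b + 1) * (a + b + 1) ≤ t * t :=
      mul_self_le_mul_self (by linarith) (by linarith)
    have e2 : c * c ≤ a * b := mul_le_mul hca hcb hc.le ha.le
    have e3 : d * d ≤ a * b := mul_le_mul hda hdb hd.le ha.le
    have e5 : a + b ≤ 2 := by linarith
    obtain rfl : a = 1 := by omega
    obtain rfl : b = 1 := by omega
    obtain rfl : c = 1 := by omega
    obtain rfl : d = 1 := by omega
    refine ⟨rfl, rfl, rfl, rfl, ?_⟩
    nlinarith
  have hall : x 0 = 1 ∧ x 1 = 1 ∧ x 2 = 1 ∧ x 3 = 1 ∧ x 4 = 3 := by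
    generalize x 0 = a at *
    generalize x 1 = b at *
    generalize x 2 = c at *
    generalize x 3 = d at *
    generalize x 4 = t at *
    have largest : (c ≤ a ∧ c ≤ b ∧ d ≤ a ∧ d ≤ b) ∨ (b ≤ a ∧ b ≤ c ∧ d ≤ a ∧ d ≤ c) ∨
        (b ≤ a ∧ b ≤ d ∧ c ≤ a ∧ c ≤ d) ∨ (a ≤ b ∧ a ≤ c ∧ d ≤ b ∧ d ≤ c) ∨
        (a ≤ b ∧ a ≤ d ∧ c ≤ b ∧ c ≤ d) ∨ (a ≤ c ∧ a ≤ d ∧ b ≤ c ∧ b ≤ d) := by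
      clear hx h0 h1 h2 h3 h4 h5 h6 h7 h8 h9 h key
      omega
    rcases largest with H | H | H | H | H | H
    · exact key a b c d t h0 h1 h2 h3 (by linarith) (by linarith) H
    · have := key a c b d t h0 h2 h1 h3 (by linarith) (by linarith) H
      tauto
    · have := key a d b c t h0 h3 h1 h2 (by linarith) (by linarith) H
      tauto
    · have := key b c a d t h1 h2 h0 h3 (by linarith) (by linarith) H
      tauto
    · have := key b d a c t h1 h3 h0 h2 (by linarith) (by linarith) H
      tauto
    · have := key c d a b t h2 h3 h0 h1 (by linarith) (by linarith) H
      tauto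
  ext i
  fin_cases i <;> simp [basePoint, hall]

theorem eq_one_of_act_basePoint {g : integralLorentzGroup} (hg : g ∈ congruenceSubgroup 2)
    (h : lorentzAct g basePoint = basePoint) : g = 1 := by
  rw [mem_congruenceSubgroup_iff] at hg
  -- Applied to the columns of g. Cauchy–Schwarz gives (1 + 3t)² ≤ 4(1 + t²), so t is 0 or -1, and
  -- parity leaves t = 0.
  have key : ∀ a b c d t : ℤ, a * a + b * b + c * c + d * d - t * t = 1 →
      a + b + c + d - t * 3 = 1 → 2 ∣ t → 2 ∣ a - 1 → a = 1 ∧ b = 0 ∧ c = 0 ∧ d = 0 ∧ t = 0 := by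
    intro a b c d t h1 h2 ht ha
    have e : 5 * (t * t) + 6 * t ≤ 3 := by
      nlinarith [sq_nonneg (a - b), sq_nonneg (a - c), sq_nonneg (a - d), sq_nonneg (b - c),
        sq_nonneg (b - d), sq_nonneg (c - d)]
    have t1 : t < 1 := by nlinarith
    have t2 : -2 < t := by nlinarith
    obtain rfl : t = 0 := by omega
    have ha0 : a ≠ 0 := by rintro rfl; omega
    have haa : 1 ≤ a * a := by
      rcases lt_or_gt_of_ne ha0 with h | h <;> nlinarith
    have hb : b = 0 := by nlinarith [mul_self_nonneg b, mul_self_nonneg c, mul_self_nonneg d]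
    have hc : c = 0 := by nlinarith [mul_self_nonneg b, mul_self_nonneg c, mul_self_nonneg d]
    have hd : d = 0 := by nlinarith [mul_self_nonneg b, mul_self_nonneg c, mul_self_nonneg d]
    omega
  have hcol : ∀ k : Fin 5, k ≠ 4 → lorentzAct g (Pi.single k 1) = Pi.single k 1 := by
    intro k hk
    have h1 := lorentzForm_act g (Pi.single k 1) (Pi.single k 1)
    have h2 := lorentzForm_act g (Pi.single k 1) basePoint
    have h3 := hg (Pi.single k 1)
    rw [h] at h2
    generalize lorentzAct g (Pi.single k 1) = v at *
    fin_cases k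
    · simp [lorentzForm, basePoint] at h1 h2
      have := key (v 0) (v 1) (v 2) (v 3) (v 4) (by linarith) (by linarith)
        (by simpa using h3 4) (by simpa using h3 0)
      ext i; fin_cases i <;> simp [this]
    · simp [lorentzForm, basePoint] at h1 h2
      have := key (v 1) (v 0) (v 2) (v 3) (v 4) (by linarith) (by linarith)
        (by simpa using h3 4) (by simpa using h3 1)
      ext i; fin_cases i <;> simp [this]
    · simp [lorentzForm, basePoint] at h1 h2
      have := key (v 2) (v 0) (v 1) (v 3) (v 4) (by linarith) (by linarith)
        (by simpa using h3 4) (by simpa using h3 2)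
      ext i; fin_cases i <;> simp [this]
    · simp [lorentzForm, basePoint] at h1 h2
      have := key (v 3) (v 0) (v 1) (v 2) (v 4) (by linarith) (by linarith)
        (by simpa using h3 4) (by simpa using h3 3)
      ext i; fin_cases i <;> simp [this]
    · exact absurd rfl hk
  have hb : basePoint = (Pi.single 0 1 + Pi.single 1 1 + Pi.single 2 1 + Pi.single 3 1 +
      (3 : ℤ) • Pi.single 4 1 : Fin 5 → ℤ) := by decide
  have h4 : lorentzAct g (Pi.single 4 1) = Pi.single 4 1 := by
    have := h
    rw [hb] at this
    simp only [map_add, map_smul, hcol 0 (by decide), hcol 1 (by decide), hcol 2 (by decide),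
      hcol 3 (by decide)] at this
    exact smul_right_injective _ (by norm_num : (3 : ℤ) ≠ 0) (add_left_cancel this)
  have hall : ∀ k : Fin 5, lorentzAct g (Pi.single k 1) = Pi.single k 1 := fun k => by
    by_cases hk : k = 4
    · rw [hk, h4]
    · exact hcol k hk
  apply lorentzAct_injective
  have : lorentzAct g = lorentzAct 1 := by
    refine LinearMap.pi_ext fun k z => ?_
    have e : (Pi.single k z : Fin 5 → ℤ) = z • Pi.single k 1 := by
      rw [← Pi.single_smul]; simp
    rw [e, map_smul, map_smul, hall, lorentzAct_one]
  simp [this]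

theorem simpleReflection_act_pos {x : Fin 5 → ℤ} (hx : lorentzForm x x = -5) (h4 : 0 < x 4)
    (a : Fin 10) : 0 < lorentzAct (simpleReflection a) x 4 := by
  -- 3t - 2(p + q) is the last coordinate after reflection in -(e_i + e_j + e_4); it is positive
  -- since (p + q)² ≤ 2t².
  have key : ∀ p q t : ℤ, p * p + q * q ≤ t * t → 0 < t → 0 < 3 * t - 2 * (p + q) := by
    intro p q t h ht
    nlinarith [sq_nonneg (p - q)]
  simp only [lorentzForm] at hx
  have b0 := mul_self_nonneg (x 0)
  have b1 := mul_self_nonneg (x 1)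
  have b2 := mul_self_nonneg (x 2)
  have b3 := mul_self_nonneg (x 3)
  have k01 := key (x 0) (x 1) (x 4) (by linarith) h4
  have k02 := key (x 0) (x 2) (x 4) (by linarith) h4
  have k03 := key (x 0) (x 3) (x 4) (by linarith) h4
  have k12 := key (x 1) (x 2) (x 4) (by linarith) h4
  have k13 := key (x 1) (x 3) (x 4) (by linarith) h4
  have k23 := key (x 2) (x 3) (x 4) (by linarith) h4
  rw [lorentzAct_simpleReflection]
  fin_cases a <;> simp [simpleRoot, lorentzForm] <;> linarith

theorem lorentzForm_basePoint_neg {x : Fin 5 → ℤ} (hx : lorentzForm x x = -5) (h4 : 0 < x 4) :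
    lorentzForm x basePoint < 0 := by
  simp only [lorentzForm] at hx
  simp [lorentzForm, basePoint]
  nlinarith [sq_nonneg (x 0 - x 1), sq_nonneg (x 0 - x 2), sq_nonneg (x 0 - x 3),
    sq_nonneg (x 1 - x 2), sq_nonneg (x 1 - x 3), sq_nonneg (x 2 - x 3)]

theorem lorentzForm_basePoint_self : lorentzForm basePoint basePoint = -5 := by decide

/-- Modulo 2 the product is unchanged by g, and at the base point it is 1. -/
theorem lorentzForm_simpleRoot_act_ne_zero {g : integralLorentzGroup}
    (hg : g ∈ congruenceSubgroup 2) (a : Fin 10) :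
    lorentzForm (simpleRoot a) (lorentzAct g basePoint) ≠ 0 := by
  intro h
  have h1 := lorentzForm_simpleRoot_basePoint a
  have h2 := mem_congruenceSubgroup_iff.1 hg basePoint
  have : (2 : ℤ) ∣ lorentzForm (simpleRoot a) (lorentzAct g basePoint) -
      lorentzForm (simpleRoot a) basePoint := by
    choose c hc using h2
    refine ⟨lorentzForm (simpleRoot a) c, ?_⟩
    simp only [lorentzForm]
    push_cast at hc
    linear_combination simpleRoot a 0 * hc 0 + simpleRoot a 1 * hc 1 + simpleRoot a 2 * hc 2 +
      simpleRoot a 3 * hc 3 - simpleRoot a 4 * hc 4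
  rw [h, h1] at this
  omega

/-- Descent on -(gb·b): if gb lies on the negative side of a wall, reflecting in that wall strictly
lowers this positive integer. If gb is on the positive side of every wall, then gb = b and g = 1. -/
theorem mem_reflectionSubgroup_of_pos {g : integralLorentzGroup} (hg : g ∈ congruenceSubgroup 2)
    (h4 : 0 < lorentzAct g basePoint 4) : g ∈ reflectionSubgroup := by
  obtain ⟨m, hm⟩ : ∃ m : ℕ, -lorentzForm (lorentzAct g basePoint) basePoint ≤ m :=
    ⟨_, Int.self_le_toNat _⟩
  induction m generalizing g with
  | zero =>
    have := lorentzForm_basePoint_neg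
      ((lorentzForm_act g _ _).trans lorentzForm_basePoint_self) h4
    push_cast at hm
    omega
  | succ m ih =>
    have hx : lorentzForm (lorentzAct g basePoint) (lorentzAct g basePoint) = -5 :=
      (lorentzForm_act g _ _).trans lorentzForm_basePoint_self
    by_cases hpos : ∀ a, 0 < lorentzForm (simpleRoot a) (lorentzAct g basePoint)
    · rw [eq_one_of_act_basePoint hg (eq_basePoint_of_forall_pos hx hpos)]
      exact one_mem _
    · push Not at hpos
      obtain ⟨a, ha⟩ := hpos
      have ha' := lt_of_le_of_ne ha (lorentzForm_simpleRoot_act_ne_zero hg a)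
      have hmem : simpleReflection a * g ∈ reflectionSubgroup := by
        apply ih (mul_mem (reflectionSubgroup_le (simpleReflection_mem a)) hg)
        · rw [lorentzAct_mul]
          exact simpleReflection_act_pos hx h4 a
        · rw [lorentzAct_mul, lorentzAct_simpleReflection]
          have h1 := lorentzForm_simpleRoot_basePoint a
          generalize lorentzForm (simpleRoot a) (lorentzAct g basePoint) = c at *
          generalize lorentzAct g basePoint = x at *
          have : lorentzForm (x - (2 * c) • simpleRoot a) basePoint =
              lorentzForm x basePoint - 2 * c * lorentzForm (simpleRoot a) basePoint := by
            simp only [lorentzForm, Pi.sub_apply, Pi.smul_apply, smul_eq_mul]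
            ring
          rw [this, h1]
          push_cast at hm
          linarith
      exact (Subgroup.mul_mem_cancel_left _ (simpleReflection_mem a)).1 hmem

theorem mem_reflectionSubgroup_or {g : integralLorentzGroup} (hg : g ∈ congruenceSubgroup 2) :
    g ∈ reflectionSubgroup ∨ lorentzNegOne * g ∈ reflectionSubgroup := by
  have hx : lorentzForm (lorentzAct g basePoint) (lorentzAct g basePoint) = -5 :=
    (lorentzForm_act g _ _).trans lorentzForm_basePoint_self
  rcases lt_trichotomy (lorentzAct g basePoint 4) 0 with h | h | h
  · right
    apply mem_reflectionSubgroup_of_pos (mul_mem lorentzNegOne_mem hg)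
    rw [lorentzAct_negOne_mul]
    simpa using h
  · exfalso
    simp only [lorentzForm, h] at hx
    nlinarith [mul_self_nonneg (lorentzAct g basePoint 0), mul_self_nonneg (lorentzAct g basePoint 1),
      mul_self_nonneg (lorentzAct g basePoint 2), mul_self_nonneg (lorentzAct g basePoint 3)]
  · exact Or.inl (mem_reflectionSubgroup_of_pos hg h)

theorem congruenceSubgroup_two_fg : (congruenceSubgroup 2).FG := by
  rw [Subgroup.fg_iff]
  refine ⟨Set.range simpleReflection ∪ {lorentzNegOne}, ?_,
    (Set.finite_range _).union (Set.finite_singleton _)⟩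
  apply le_antisymm
  · rw [Subgroup.closure_le]
    rintro _ (⟨a, rfl⟩ | rfl)
    · exact lorentzReflection_mem _
    · exact lorentzNegOne_mem
  · intro g hg
    have hle : reflectionSubgroup ≤
        Subgroup.closure (Set.range simpleReflection ∪ {lorentzNegOne}) :=
      Subgroup.closure_mono Set.subset_union_left
    rcases mem_reflectionSubgroup_or hg with h | h
    · exact hle h
    · have hneg : lorentzNegOne ∈
          Subgroup.closure (Set.range simpleReflection ∪ {lorentzNegOne}) :=
        Subgroup.subset_closure (Or.inr rfl)
      exact (Subgroup.mul_mem_cancel_left _ hneg).1 (hle h)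

/-- Schreier's lemma: a finite index subgroup of the finitely generated group Γ(2). -/
theorem congruenceSubgroup_fg (N : ℕ) [NeZero N] (hN : 2 ∣ N) :
    Group.FG (congruenceSubgroup N) := by
  have : Group.FG (congruenceSubgroup 2) :=
    (Group.fg_iff_subgroup_fg (congruenceSubgroup 2)).2 congruenceSubgroup_two_fg
  have : Group.FG ((congruenceSubgroup N).subgroupOf (congruenceSubgroup 2)) :=
    Subgroup.fg_of_index_ne_zero _
  exact Group.fg_of_surjective (f := MulEquiv.toMonoidHom _)
    (Subgroup.subgroupOfEquivOfLe (congruenceSubgroup_anti hN)).surjective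

/-! ### Γ(4) lies in the reflection group -/

theorem simpleReflection_inv (a : Fin 10) : (simpleReflection a)⁻¹ = simpleReflection a :=
  inv_eq_of_mul_eq_one_right (lorentzReflection_mul_self _)

theorem reflectionSubgroup_induction {p : integralLorentzGroup → Prop} (one : p 1)
    (mul_left : ∀ a, ∀ g ∈ reflectionSubgroup, p g → p (simpleReflection a * g))
    {g : integralLorentzGroup} (hg : g ∈ reflectionSubgroup) : p g := by
  induction hg using Subgroup.closure_induction_left with
  | one => exact one
  | mul_left x hx y hy ih =>
    obtain ⟨a, rfl⟩ := hx
    exact mul_left a y hy ih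
  | inv_mul_cancel x hx y hy ih =>
    obtain ⟨a, rfl⟩ := hx
    rw [simpleReflection_inv]
    exact mul_left a y hy ih

/-- A linear functional of the matrix entries whose residue modulo four separates `-1` from the
products of simple reflections. -/
def signFunctional (g : integralLorentzGroup) : ℤ :=
  lorentzAct g (Pi.single 4 1) 4 - 1 + lorentzAct g (Pi.single 0 1) 1 +
    lorentzAct g (Pi.single 0 1) 2 + lorentzAct g (Pi.single 0 1) 3 +
    lorentzAct g (Pi.single 1 1) 2 + lorentzAct g (Pi.single 1 1) 3 +
    lorentzAct g (Pi.single 2 1) 3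

/-- For g in Γ(2), left multiplication by the reflection in e_i does not change the functional mod
4. The reflection in -(e_i + e_j + e_4) shifts, mod 4, exactly two of the summands by 2: the corner
entry and the one for the pair {i, j}. -/
theorem four_dvd_signFunctional {g : integralLorentzGroup} (hg : g ∈ reflectionSubgroup) :
    4 ∣ signFunctional g := by
  refine reflectionSubgroup_induction (p := fun g => 4 ∣ signFunctional g) ?_ ?_ hg
  · simp [signFunctional]
  · intro a g hg ih
    have h2 := mem_congruenceSubgroup_iff.1 (reflectionSubgroup_le hg)
    simp only [signFunctional, lorentzAct_mul, lorentzAct_simpleReflection] at ih ⊢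
    have h0 := h2 (Pi.single 0 1)
    have h1 := h2 (Pi.single 1 1)
    have h3 := h2 (Pi.single 2 1)
    have h4 := h2 (Pi.single 4 1)
    clear h2
    generalize lorentzAct g (Pi.single 0 1) = x0 at *
    generalize lorentzAct g (Pi.single 1 1) = x1 at *
    generalize lorentzAct g (Pi.single 2 1) = x2 at *
    generalize lorentzAct g (Pi.single 4 1) = x4 at *
    simp only [Fin.forall_fin_succ, Nat.cast_ofNat, Pi.single_apply, IsEmpty.forall_iff] at h0 h1 h3 h4
    simp at h0 h1 h3 h4
    fin_cases a <;> simp [simpleRoot, lorentzForm] <;> omega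

/-- If g ≡ I mod 4, then the functional of -g is ≡ -2 mod 4, so -g is not a product of simple
reflections. -/
theorem congruenceSubgroup_four_le : congruenceSubgroup 4 ≤ reflectionSubgroup := by
  intro g hg
  refine (mem_reflectionSubgroup_or (congruenceSubgroup_anti (by norm_num) hg)).resolve_right ?_
  intro h
  have h1 := four_dvd_signFunctional h
  have h2 := mem_congruenceSubgroup_iff.1 hg
  simp only [signFunctional, lorentzAct_negOne_mul, Pi.neg_apply] at h1
  have a1 := h2 (Pi.single 4 1) 4
  have a2 := h2 (Pi.single 0 1) 1
  have a3 := h2 (Pi.single 0 1) 2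
  have a4 := h2 (Pi.single 0 1) 3
  have a5 := h2 (Pi.single 1 1) 2
  have a6 := h2 (Pi.single 1 1) 3
  have a7 := h2 (Pi.single 2 1) 3
  simp at a1 a2 a3 a4 a5 a6 a7
  omega

/-! ### Signed wall crossings -/

/-- For a vector `v` of norm one, the signed number of times a path from the base point to its
image under `g` crosses the wall `v⊥` to the positive side of `v`. -/
def wallCrossing (g : integralLorentzGroup) (v : Fin 5 → ℤ) : ℤ :=
  if lorentzForm v v = 1 then
    (if 0 < lorentzForm v (lorentzAct g basePoint) then 1 else 0) -
      (if 0 < lorentzForm v basePoint then 1 else 0)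
  else 0

/-- The simple root congruent to `v` modulo two, for `v` of norm one. -/
def wallType (v : Fin 5 → ℤ) : Fin 5 → ℤ :=
  fun k => (1 - 2 * (v 4 % 2)) * (v k % 2)

theorem wallType_simpleRoot (a : Fin 10) : wallType (simpleRoot a) = simpleRoot a := by
  revert a; decide

theorem wallType_congr {v w : Fin 5 → ℤ} (h : ∀ k, (2 : ℤ) ∣ v k - w k) :
    wallType v = wallType w := by
  have (k : Fin 5) : v k % 2 = w k % 2 := by have := h k; omega
  funext k
  simp only [wallType, this]

theorem wallType_neg (v : Fin 5 → ℤ) : wallType (-v) = wallType v :=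
  wallType_congr fun k => ⟨-v k, by simp; ring⟩

theorem wallType_act {g : integralLorentzGroup} (hg : g ∈ congruenceSubgroup 2)
    (v : Fin 5 → ℤ) : wallType (lorentzAct g v) = wallType v :=
  wallType_congr (mem_congruenceSubgroup_iff.1 hg v)

/-- The action of an element of `O(4,1;ℤ)` as a permutation of `ℤ⁵`. -/
def lorentzPerm (g : integralLorentzGroup) : (Fin 5 → ℤ) ≃ (Fin 5 → ℤ) where
  toFun := lorentzAct g
  invFun := lorentzAct g⁻¹
  left_inv := lorentzAct_inv_apply g
  right_inv := lorentzAct_apply_inv g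

theorem wallCrossing_one : wallCrossing 1 = 0 := by
  ext v; simp [wallCrossing]

/-- Telescoping through the intermediate point gb: the path from gb to ghb is the g-translate of the
path from b to hb. -/
theorem wallCrossing_mul (g h : integralLorentzGroup) (v : Fin 5 → ℤ) :
    wallCrossing (g * h) v = wallCrossing g v + wallCrossing h (lorentzAct g⁻¹ v) := by
  simp only [wallCrossing, lorentzForm_inv_act, lorentzAct_mul, lorentzAct_apply_inv]
  split_ifs <;> simp

/-- The base point has odd coordinates and squares preserve parity, so v·b ≡ v·v mod 2. In
particular b lies on no wall. -/
theorem lorentzForm_basePoint_odd {v : Fin 5 → ℤ} (hv : lorentzForm v v = 1) :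
    lorentzForm v basePoint % 2 = 1 := by
  simp [lorentzForm, basePoint] at hv ⊢
  have (a : ℤ) : ∃ c, a * a = a + 2 * c := by
    obtain ⟨c, hc⟩ := Int.even_mul_succ_self (a - 1)
    exact ⟨c, by linear_combination hc⟩
  obtain ⟨c0, h0⟩ := this (v 0)
  obtain ⟨c1, h1⟩ := this (v 1)
  obtain ⟨c2, h2⟩ := this (v 2)
  obtain ⟨c3, h3⟩ := this (v 3)
  obtain ⟨c4, h4⟩ := this (v 4)
  omega

theorem wallCrossing_neg (g : integralLorentzGroup) (v : Fin 5 → ℤ) :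
    wallCrossing g (-v) = -wallCrossing g v := by
  have hn : lorentzForm (-v) (-v) = lorentzForm v v := by simp [lorentzForm]
  by_cases hv : lorentzForm v v = 1
  · have h1 := lorentzForm_basePoint_odd hv
    have hv' : lorentzForm (lorentzAct g⁻¹ v) (lorentzAct g⁻¹ v) = 1 :=
      (lorentzForm_act _ _ _).trans hv
    have h2 := lorentzForm_basePoint_odd hv'
    rw [lorentzForm_inv_act] at h2
    simp only [wallCrossing, hn, hv, lorentzForm_neg_left]
    split_ifs <;> omega
  · simp [wallCrossing, hn, hv]

/-- A vector orthogonal to a timelike vector is spacelike or zero. -/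
theorem eq_zero_of_orthogonal {r y : Fin 5 → ℤ} (hy : lorentzForm y y < 0)
    (hry : lorentzForm r y = 0) (hr : lorentzForm r r ≤ 0) : r = 0 := by
  simp only [lorentzForm] at hy hry hr
  have cs : (r 4 * y 4) * (r 4 * y 4) ≤
      (r 0 * r 0 + r 1 * r 1 + r 2 * r 2 + r 3 * r 3) *
        (y 0 * y 0 + y 1 * y 1 + y 2 * y 2 + y 3 * y 3) := by
    have : r 4 * y 4 = r 0 * y 0 + r 1 * y 1 + r 2 * y 2 + r 3 * y 3 := by linarith
    rw [this]
    nlinarith [sq_nonneg (r 0 * y 1 - r 1 * y 0), sq_nonneg (r 0 * y 2 - r 2 * y 0),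
      sq_nonneg (r 0 * y 3 - r 3 * y 0), sq_nonneg (r 1 * y 2 - r 2 * y 1),
      sq_nonneg (r 1 * y 3 - r 3 * y 1), sq_nonneg (r 2 * y 3 - r 3 * y 2)]
  have m0 := mul_self_nonneg (r 0)
  have m1 := mul_self_nonneg (r 1)
  have m2 := mul_self_nonneg (r 2)
  have m3 := mul_self_nonneg (r 3)
  have h4 : r 4 = 0 := by
    by_contra h
    have h4 : 0 < r 4 * r 4 := mul_self_pos.2 h
    have hY : 0 ≤ y 0 * y 0 + y 1 * y 1 + y 2 * y 2 + y 3 * y 3 := by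
      linarith [mul_self_nonneg (y 0), mul_self_nonneg (y 1), mul_self_nonneg (y 2),
        mul_self_nonneg (y 3)]
    have a1 := mul_le_mul_of_nonneg_right
      (by linarith : r 0 * r 0 + r 1 * r 1 + r 2 * r 2 + r 3 * r 3 ≤ r 4 * r 4) hY
    have a2 := mul_lt_mul_of_pos_left
      (by linarith : y 0 * y 0 + y 1 * y 1 + y 2 * y 2 + y 3 * y 3 < y 4 * y 4) h4
    linarith
  rw [h4] at hr
  have z0 : r 0 = 0 := mul_self_eq_zero.1 (by linarith)
  have z1 : r 1 = 0 := mul_self_eq_zero.1 (by linarith)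
  have z2 : r 2 = 0 := mul_self_eq_zero.1 (by linarith)
  have z3 : r 3 = 0 := mul_self_eq_zero.1 (by linarith)
  ext i
  fin_cases i <;> simp [*]

/-- The only wall between the base point and its mirror image in a simple wall is that wall. -/
theorem eq_of_separates {n v : Fin 5 → ℤ} (hn : lorentzForm n n = 1)
    (hnb : lorentzForm n basePoint = 1) (hv : lorentzForm v v = 1)
    (h0 : 0 < lorentzForm v basePoint) (h1 : lorentzForm v basePoint < 2 * lorentzForm n v) :
    v = n := by
  set a := lorentzForm n v with ha
  set b := lorentzForm v basePoint with hb
  have hbb := lorentzForm_basePoint_self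
  -- The point y = b - n is timelike and lies on the wall n⊥, midway between b and its mirror image
  -- b - 2n. Vectors orthogonal to y are therefore spacelike or zero.
  have hy : lorentzForm (basePoint - n) (basePoint - n) = -6 := by
    have : lorentzForm (basePoint - n) (basePoint - n) = lorentzForm basePoint basePoint -
        2 * lorentzForm n basePoint + lorentzForm n n := by
      simp only [lorentzForm, Pi.sub_apply]; ring
    rw [this, hn, hnb, hbb]; norm_num
  have hform (p q r s t u : ℤ) : lorentzForm (p • v + q • n + r • basePoint)
      (s • v + t • n + u • basePoint) = p * s + q * t - 5 * (r * u) + (p * t + q * s) * a +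
        (p * u + r * s) * b + (q * u + r * t) := by
    have : lorentzForm (p • v + q • n + r • basePoint) (s • v + t • n + u • basePoint) =
        p * s * lorentzForm v v + q * t * lorentzForm n n +
        r * u * lorentzForm basePoint basePoint + (p * t + q * s) * lorentzForm n v +
        (p * u + r * s) * lorentzForm v basePoint +
        (q * u + r * t) * lorentzForm n basePoint := by
      simp only [lorentzForm, Pi.add_apply, Pi.smul_apply, smul_eq_mul]; ring
    rw [this, hv, hn, hbb, hnb, ← ha, ← hb]; ring
  have hz : ∀ r : Fin 5 → ℤ, lorentzForm r (basePoint - n) = 0 → lorentzForm r r ≤ 0 → r = 0 :=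
    fun r => eq_zero_of_orthogonal (by rw [hy]; norm_num)
  have e1 : basePoint - n = (0 : ℤ) • v + (-1 : ℤ) • n + (1 : ℤ) • basePoint := by
    ext i; simp; ring
  have hab : a = 1 ∧ b = 1 := by
    by_contra hne
    have hpos : 6 < 6 * (a * a) - (b - a) * (b - a) := by
      have ha1 : 1 ≤ a := by omega
      rcases eq_or_lt_of_le ha1 with h | h
      · exact absurd ⟨h.symm, by omega⟩ hne
      · have : (b - a) * (b - a) ≤ a * a := by nlinarith
        nlinarith
    -- This is 6 times the component of v orthogonal to both n and y. Its norm is 6(6 - 6a² + (b -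
    -- a)²) < 0, which forces it to be 0; its product with v is 6 - 6a² + (b - a)², which is not 0.
    have := hz ((6 : ℤ) • v + (-(6 * a) - (b - a)) • n + (b - a) • basePoint)
      (by rw [e1, hform]; ring) (by rw [hform]; nlinarith)
    have h2 := hform 6 (-(6 * a) - (b - a)) (b - a) 1 0 0
    rw [this] at h2
    have h3 : lorentzForm 0 ((1 : ℤ) • v + (0 : ℤ) • n + (0 : ℤ) • basePoint) = 0 := by
      simp [lorentzForm]
    nlinarith
  obtain ⟨ha1, hb1⟩ := hab
  -- With a = b = 1, the vector v - n is isotropic and orthogonal to y, hence zero.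
  have := hz ((1 : ℤ) • v + (-1 : ℤ) • n + (0 : ℤ) • basePoint)
      (by rw [e1, hform, ha1, hb1]; ring) (by rw [hform, ha1, hb1]; norm_num)
  ext i
  have := congrFun this i
  simp at this
  linarith

theorem wallCrossing_simpleReflection_eq_zero {a : Fin 10} {v : Fin 5 → ℤ}
    (h1 : v ≠ simpleRoot a) (h2 : v ≠ -simpleRoot a) :
    wallCrossing (simpleReflection a) v = 0 := by
  have hn := lorentzForm_simpleRoot a
  have hnb := lorentzForm_simpleRoot_basePoint a
  have key : ∀ w : Fin 5 → ℤ, lorentzForm w w = 1 → w ≠ simpleRoot a →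
      0 < lorentzForm w basePoint →
      0 < lorentzForm w (lorentzAct (simpleReflection a) basePoint) := by
    intro w hw hwn hpos
    have hodd := lorentzForm_basePoint_odd hw
    have : lorentzForm w (lorentzAct (simpleReflection a) basePoint) =
        lorentzForm w basePoint - 2 * lorentzForm (simpleRoot a) w := by
      rw [lorentzAct_simpleReflection, hnb]
      simp only [lorentzForm, Pi.sub_apply, Pi.smul_apply, smul_eq_mul]; ring
    rw [this]
    by_contra hcon
    exact hwn (eq_of_separates hn hnb hw hpos (by omega))
  by_cases hv : lorentzForm v v = 1
  · have hodd := lorentzForm_basePoint_odd hv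
    have hv' : lorentzForm (-v) (-v) = 1 := by rw [← hv]; simp [lorentzForm]
    have k1 := key v hv h1
    have k2 := key (-v) hv' (fun h => h2 (by rw [← h, neg_neg]))
    rw [lorentzForm_neg_left, lorentzForm_neg_left] at k2
    simp only [wallCrossing, hv]
    split_ifs <;> omega
  · simp [wallCrossing, hv]

theorem wallCrossing_simpleReflection_self (a : Fin 10) :
    wallCrossing (simpleReflection a) (simpleRoot a) = -1 := by
  revert a
  simp only [wallCrossing, lorentzAct_simpleReflection]
  decide

/-! ### The displacement formula -/

/-- The sum of the rank one maps `y ↦ (τ(v)·y) v` over all walls between the base point and its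
image, where `τ(v)` is the type of the wall. -/
noncomputable def wallSum (g : integralLorentzGroup) (y : Fin 5 → ℤ) : Fin 5 → ℤ :=
  ∑ᶠ v, (wallCrossing g v * lorentzForm (wallType v) y) • v

theorem support_wallCrossing_simpleReflection (a : Fin 10) :
    Function.support (wallCrossing (simpleReflection a)) ⊆
      (({simpleRoot a, -simpleRoot a} : Finset (Fin 5 → ℤ)) : Set (Fin 5 → ℤ)) := by
  intro v hv
  by_contra h
  simp only [Finset.coe_insert, Finset.coe_singleton, Set.mem_insert_iff, Set.mem_singleton_iff,
    not_or] at h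
  exact hv (wallCrossing_simpleReflection_eq_zero h.1 h.2)

theorem support_smul_subset (f φ : (Fin 5 → ℤ) → ℤ) :
    (Function.support fun v => (f v * φ v) • v) ⊆ Function.support f := by
  intro v hv h
  exact hv (by simp [h])

/-- Only n and -n are crossed, with opposite signs and the same type n. Each contributes -(n·y) n,
giving the full displacement -2(n·y) n. -/
theorem wallSum_simpleReflection (a : Fin 10) (y : Fin 5 → ℤ) :
    wallSum (simpleReflection a) y = lorentzAct (simpleReflection a) y - y := by
  rw [wallSum, finsum_eq_sum_of_support_subset _
    ((support_smul_subset _ _).trans (support_wallCrossing_simpleReflection a)),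
    Finset.sum_pair, wallCrossing_neg, wallType_neg, wallCrossing_simpleReflection_self,
    wallType_simpleRoot, lorentzAct_simpleReflection]
  · ext i; simp; ring
  · revert a; decide

/-- Reindexing the second sum by g keeps its coefficients, because g in Γ(2) preserves wall types.
-/
theorem wallSum_mul {g h : integralLorentzGroup} (hg : g ∈ congruenceSubgroup 2)
    (fg : (Function.support (wallCrossing g)).Finite)
    (fh : (Function.support (wallCrossing h)).Finite) (y : Fin 5 → ℤ) :
    wallSum (g * h) y = wallSum g y + lorentzAct g (wallSum h y) := by
  have fg' := fg.subset (support_smul_subset _ fun v => lorentzForm (wallType v) y)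
  have fh' := fh.subset (support_smul_subset _ fun v => lorentzForm (wallType v) y)
  have e : lorentzAct g (wallSum h y) = ∑ᶠ v, (wallCrossing h (lorentzAct g⁻¹ v) *
      lorentzForm (wallType v) y) • v := by
    rw [wallSum, map_finsum _ fh', ← finsum_comp_equiv (lorentzPerm g)
      (f := fun v => (wallCrossing h (lorentzAct g⁻¹ v) * lorentzForm (wallType v) y) • v)]
    refine finsum_congr fun v => ?_
    change lorentzAct g _ = (wallCrossing h (lorentzAct g⁻¹ (lorentzAct g v)) *
      lorentzForm (wallType (lorentzAct g v)) y) • lorentzAct g v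
    rw [lorentzAct_inv_apply, wallType_act hg, map_smul]
  rw [e, wallSum, wallSum, ← finsum_add_distrib fg']
  · refine finsum_congr fun v => ?_
    rw [wallCrossing_mul, add_mul, add_smul]
  · refine (fh.preimage (lorentzPerm g⁻¹).injective.injOn).subset ?_
    exact support_smul_subset (fun v => wallCrossing h (lorentzAct g⁻¹ v)) _

theorem finite_support_wallCrossing_mul {g h : integralLorentzGroup}
    (fg : (Function.support (wallCrossing g)).Finite)
    (fh : (Function.support (wallCrossing h)).Finite) :
    (Function.support (wallCrossing (g * h))).Finite := by
  refine (fg.union (fh.preimage (lorentzPerm g⁻¹).injective.injOn)).subset ?_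
  intro v hv
  rw [Function.mem_support, wallCrossing_mul] at hv
  by_contra hcon
  simp only [Set.mem_union, Set.mem_preimage, Function.mem_support, not_or, not_not] at hcon
  exact hv (by rw [hcon.1, zero_add]; exact hcon.2)

theorem finite_support_wallCrossing {g : integralLorentzGroup} (hg : g ∈ reflectionSubgroup) :
    (Function.support (wallCrossing g)).Finite := by
  refine reflectionSubgroup_induction
    (p := fun g => (Function.support (wallCrossing g)).Finite) ?_ ?_ hg
  · simp [wallCrossing_one]
  · intro a g _ ih
    exact finite_support_wallCrossing_mul
      ((Finset.finite_toSet _).subset (support_wallCrossing_simpleReflection a)) ih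

theorem wallSum_eq {g : integralLorentzGroup} (hg : g ∈ reflectionSubgroup) (y : Fin 5 → ℤ) :
    wallSum g y = lorentzAct g y - y := by
  refine reflectionSubgroup_induction (p := fun g => wallSum g y = lorentzAct g y - y) ?_ ?_ hg
  · simp [wallSum, wallCrossing_one]
  · intro a g hg ih
    rw [wallSum_mul (reflectionSubgroup_le (simpleReflection_mem a))
      (finite_support_wallCrossing (simpleReflection_mem a)) (finite_support_wallCrossing hg), ih,
      wallSum_simpleReflection, map_sub, lorentzAct_mul]
    abel

/-! ### Crossing numbers of classes modulo N -/

/-- A homomorphism to ℤ induces a map G^ab ⊗ ℚ → ℚ, and ℤ → ℚ is injective. -/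
theorem map_eq_one_of_mem_rationalCommutator {G : Type*} [Group G] (φ : G →* Multiplicative ℤ)
    {g : G} (hg : g ∈ rationalCommutator G) : φ g = 1 := by
  let ψ : Additive (Abelianization G) →ₗ[ℤ] ℤ :=
    (MonoidHom.toAdditiveLeft (Abelianization.lift φ)).toIntLinearMap
  have h : (Additive.ofMul (Abelianization.of g) ⊗ₜ[ℤ] (1 : ℚ)) = 0 := hg
  have h2 := congrArg (TensorProduct.lid ℤ ℚ ∘ TensorProduct.map ψ LinearMap.id) h
  simp only [Function.comp_apply, TensorProduct.map_tmul, map_zero, LinearMap.id_apply,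
    TensorProduct.lid_tmul, zsmul_eq_mul, mul_one, Int.cast_eq_zero] at h2
  have h3 : ψ (Additive.ofMul (Abelianization.of g)) = Multiplicative.toAdd (φ g) := by
    simp [ψ]
  rw [h3] at h2
  exact h2

/-- Reduction of integral vectors modulo `N`. -/
def reduceVec (N : ℕ) (v : Fin 5 → ℤ) : Fin 5 → ZMod N := fun k => (v k : ZMod N)

theorem reduceVec_eq_iff {N : ℕ} {v w : Fin 5 → ℤ} :
    reduceVec N v = reduceVec N w ↔ ∀ k, (N : ℤ) ∣ v k - w k := by
  rw [funext_iff]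
  refine forall_congr' fun k => ?_
  rw [reduceVec, reduceVec, ← ZMod.intCast_zmod_eq_zero_iff_dvd, Int.cast_sub, sub_eq_zero]

theorem reduceVec_act {N : ℕ} {g : integralLorentzGroup} (hg : g ∈ congruenceSubgroup N)
    (v : Fin 5 → ℤ) : reduceVec N (lorentzAct g v) = reduceVec N v :=
  reduceVec_eq_iff.2 (mem_congruenceSubgroup_iff.1 hg v)

open Classical in
/-- The signed number of crossings of walls whose normal lies in a given class modulo `N`. -/
noncomputable def classCrossing (N : ℕ) (c : Fin 5 → ZMod N) (g : integralLorentzGroup) : ℤ :=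
  ∑ᶠ v, if reduceVec N v = c then wallCrossing g v else 0

/-- In the cocycle rule for crossings the twist by g permutes the walls within each class mod N, so
it disappears from the sum. -/
theorem classCrossing_mul {N : ℕ} (c : Fin 5 → ZMod N) {g h : integralLorentzGroup}
    (hg : g ∈ congruenceSubgroup N) (fg : (Function.support (wallCrossing g)).Finite)
    (fh : (Function.support (wallCrossing h)).Finite) :
    classCrossing N c (g * h) = classCrossing N c g + classCrossing N c h := by
  classical
  have hsupp (f : (Fin 5 → ℤ) → ℤ) :
      (Function.support fun v => if reduceVec N v = c then f v else 0) ⊆ Function.support f := by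
    intro v hv hf
    exact hv (by simp [hf])
  have e : classCrossing N c h =
      ∑ᶠ v, if reduceVec N v = c then wallCrossing h (lorentzAct g⁻¹ v) else 0 := by
    rw [classCrossing, ← finsum_comp_equiv (lorentzPerm g)
      (f := fun v => if reduceVec N v = c then wallCrossing h (lorentzAct g⁻¹ v) else 0)]
    refine finsum_congr fun v => ?_
    change _ = if reduceVec N (lorentzAct g v) = c then
      wallCrossing h (lorentzAct g⁻¹ (lorentzAct g v)) else 0
    rw [lorentzAct_inv_apply, reduceVec_act hg]
  rw [e, classCrossing, classCrossing, ← finsum_add_distrib (fg.subset (hsupp _))]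
  · refine finsum_congr fun v => ?_
    rw [wallCrossing_mul]
    split_ifs <;> simp
  · refine (fh.preimage (lorentzPerm g⁻¹).injective.injOn).subset ?_
    exact hsupp fun v => wallCrossing h (lorentzAct g⁻¹ v)

/-- The crossing number of a class of walls as a homomorphism on a subgroup of `Γ(N)`. -/
noncomputable def classCrossingHom (N : ℕ) (c : Fin 5 → ZMod N) {H : Type*} [Group H]
    (f : H →* integralLorentzGroup) (hN : ∀ x, f x ∈ congruenceSubgroup N)
    (hW : ∀ x, f x ∈ reflectionSubgroup) : H →* Multiplicative ℤ :=
  MonoidHom.mk' (fun x => Multiplicative.ofAdd (classCrossing N c (f x))) fun x y => by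
    rw [map_mul, classCrossing_mul c (hN x) (finite_support_wallCrossing (hW x))
      (finite_support_wallCrossing (hW y)), ofAdd_add]

/-- If all signed crossing numbers modulo `N` vanish, then a sum over crossed walls of a function
of the wall modulo `N` vanishes modulo `N`. -/
theorem dvd_sum_wallCrossing {N : ℕ} [NeZero N] {g : integralLorentzGroup}
    (fg : (Function.support (wallCrossing g)).Finite) (h0 : ∀ c, classCrossing N c g = 0)
    {F : (Fin 5 → ℤ) → ℤ} (hF : ∀ v w, reduceVec N v = reduceVec N w → (N : ℤ) ∣ F v - F w) :
    (N : ℤ) ∣ ∑ v ∈ fg.toFinset, wallCrossing g v * F v := by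
  classical
  rw [← Finset.sum_fiberwise _ (reduceVec N)]
  refine Finset.dvd_sum fun c _ => ?_
  let w : Fin 5 → ℤ := fun k => ((c k).val : ℤ)
  have hw : reduceVec N w = c := by
    ext k; simp [reduceVec, w]
  have hc : ∑ v ∈ fg.toFinset with reduceVec N v = c, wallCrossing g v = 0 := by
    rw [← h0 c, classCrossing, finsum_eq_sum_of_support_subset (s := fg.toFinset),
      Finset.sum_filter]
    intro v hv
    simp only [Function.mem_support, ne_eq, ite_eq_right_iff, Classical.not_imp] at hv
    simpa using hv.2
  -- Since the crossings in the class add up to 0, the constant F w can be subtracted from F.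
  have : ∑ v ∈ fg.toFinset with reduceVec N v = c, wallCrossing g v * F v =
      ∑ v ∈ fg.toFinset with reduceVec N v = c, wallCrossing g v * (F v - F w) := by
    simp only [mul_sub, Finset.sum_sub_distrib]
    rw [← Finset.sum_mul, hc]
    simp
  rw [this]
  refine Finset.dvd_sum fun v hv => (hF v w ?_).mul_left _
  rw [hw]
  exact (Finset.mem_filter.1 hv).2

theorem mem_congruenceSubgroup_two_mul {N : ℕ} [NeZero N] (hN : 4 ∣ N) {g : integralLorentzGroup}
    (hg : g ∈ reflectionSubgroup) (h0 : ∀ c, classCrossing N c g = 0) :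
    g ∈ congruenceSubgroup (2 * N) := by
  have fg := finite_support_wallCrossing hg
  rw [mem_congruenceSubgroup_iff]
  intro y i
  let q : (Fin 5 → ℤ) → ℤ := fun v => lorentzForm (wallType v) y * v i
  -- As v·b is odd, exactly one of v, -v has v·b ≡ 1 mod 4. This choice depends only on v mod 4,
  -- hence on its class mod N; a choice by the sign of v·b would not.
  let F : (Fin 5 → ℤ) → ℤ := fun v => if lorentzForm v basePoint % 4 = 1 then q v else 0
  let F' : (Fin 5 → ℤ) → ℤ := fun v => if lorentzForm v basePoint % 4 = 1 then 0 else q v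
  have h4 : (4 : ℤ) ∣ N := by exact_mod_cast hN
  have hF : ∀ v w, reduceVec N v = reduceVec N w → (N : ℤ) ∣ F v - F w := by
    intro v w hvw
    rw [reduceVec_eq_iff] at hvw
    have h1 : wallType v = wallType w :=
      wallType_congr fun k => (Dvd.dvd.trans (by norm_num) h4).trans (hvw k)
    have h2 : lorentzForm v basePoint % 4 = lorentzForm w basePoint % 4 := by
      have a0 := h4.trans (hvw 0)
      have a1 := h4.trans (hvw 1)
      have a2 := h4.trans (hvw 2)
      have a3 := h4.trans (hvw 3)
      have a4 := h4.trans (hvw 4)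
      simp [lorentzForm, basePoint]
      omega
    simp only [F, q, h1, h2]
    split_ifs
    · rw [← mul_sub]
      exact (hvw i).mul_left _
    · simp
  have hsum : lorentzAct g y i - y i = ∑ v ∈ fg.toFinset, wallCrossing g v * q v := by
    have := congrFun (wallSum_eq hg y) i
    rw [Pi.sub_apply] at this
    rw [← this, wallSum, finsum_eq_sum_of_support_subset (s := fg.toFinset) _
      (by simpa using support_smul_subset (wallCrossing g) _), Finset.sum_apply]
    exact Finset.sum_congr rfl fun v _ => by simp [q, mul_assoc]
  -- Under v ↦ -v both the crossing number and q change sign, while the two halves are exchanged.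
  have hflip : ∑ v ∈ fg.toFinset, wallCrossing g v * F' v =
      ∑ v ∈ fg.toFinset, wallCrossing g v * F v := by
    refine Finset.sum_bij' (fun v _ => -v) (fun v _ => -v) ?_ ?_ ?_ ?_ ?_
    · intro v hv
      simpa [wallCrossing_neg] using hv
    · intro v hv
      simpa [wallCrossing_neg] using hv
    · simp
    · simp
    · intro v hv
      have hv1 : lorentzForm v v = 1 := by
        by_contra hne
        simp [wallCrossing, hne] at hv
      have hodd := lorentzForm_basePoint_odd hv1
      simp only [F, F', q, wallCrossing_neg, lorentzForm_neg_left, wallType_neg, Pi.neg_apply]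
      split_ifs
      · omega
      · simp
      · ring
      · omega
  have hdvd := dvd_sum_wallCrossing fg h0 hF
  have htwo : lorentzAct g y i - y i = 2 * ∑ v ∈ fg.toFinset, wallCrossing g v * F v := by
    rw [hsum, two_mul]
    nth_rewrite 1 [← hflip]
    rw [← Finset.sum_add_distrib]
    refine Finset.sum_congr rfl fun v _ => ?_
    simp only [F, F']
    split_ifs <;> simp
  rw [htwo]
  push_cast
  exact mul_dvd_mul_left 2 hdvd

/-! ### The tower -/

/-- The subgroup `Γ(2^(j+2))` of `Γ(4)`. -/
def congruenceTower (j : ℕ) : Subgroup (congruenceSubgroup 4) :=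
  (congruenceSubgroup (2 ^ (j + 2))).subgroupOf (congruenceSubgroup 4)

theorem map_rationalCommutator_le (j : ℕ) :
    (rationalCommutator (congruenceTower j)).map (congruenceTower j).subtype ≤
      congruenceTower (j + 1) := by
  rintro _ ⟨g, hg, rfl⟩
  have hW (x : congruenceTower j) : (x : congruenceSubgroup 4).1 ∈ reflectionSubgroup :=
    congruenceSubgroup_four_le x.1.2
  have : (g : congruenceSubgroup 4).1 ∈ congruenceSubgroup (2 * 2 ^ (j + 2)) := by
    refine mem_congruenceSubgroup_two_mul ⟨2 ^ j, by ring⟩ (hW g) fun c => ?_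
    exact map_eq_one_of_mem_rationalCommutator
      (classCrossingHom (2 ^ (j + 2)) c
        ((congruenceSubgroup 4).subtype.comp (congruenceTower j).subtype)
        (fun x => x.2) hW) hg
  rw [← pow_succ'] at this
  exact this

theorem eq_one_of_forall_mem {g : integralLorentzGroup}
    (h : ∀ j : ℕ, g ∈ congruenceSubgroup (2 ^ (j + 2))) : g = 1 := by
  apply lorentzAct_injective
  intro x
  ext i
  rw [lorentzAct_one]
  by_contra hne
  have hpos : lorentzAct g x i - x i ≠ 0 := sub_ne_zero.2 hne
  set d := lorentzAct g x i - x i with hd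
  -- A nonzero d is not divisible by 2^(|d|+2), which exceeds |d|.
  have hdvd := mem_congruenceSubgroup_iff.1 (h d.natAbs) x i
  rw [← hd, Int.natCast_dvd] at hdvd
  have h1 := Nat.le_of_dvd (Int.natAbs_pos.2 hpos) hdvd
  have h2 : d.natAbs < 2 ^ d.natAbs := Nat.lt_two_pow_self
  have h3 : 2 ^ d.natAbs ≤ 2 ^ (d.natAbs + 2) := Nat.pow_le_pow_right (by norm_num) (by omega)
  omega

theorem isRFRSTower_congruenceTower : IsRFRSTower congruenceTower where
  fg := congruenceSubgroup_fg 4 (by norm_num)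
  zero := by simp [congruenceTower]
  succ_le j g hg := congruenceSubgroup_anti (pow_dvd_pow 2 (by omega)) hg
  finiteIndex j := by
    unfold congruenceTower
    infer_instance
  iInf_eq_bot := by
    rw [eq_bot_iff]
    intro g hg
    rw [Subgroup.mem_iInf] at hg
    exact Subtype.ext (eq_one_of_forall_mem hg)
  rationalCommutator_le := map_rationalCommutator_le

theorem proposition3p3 :
    ∃ T : ℕ → Subgroup (congruenceSubgroup 4),
      IsRFRSTower T ∧
        ∀ j, ∃ n : ℕ, congruenceSubgroup (2 ^ n) ≤ (T j).map (congruenceSubgroup 4).subtype := by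
  refine ⟨congruenceTower, isRFRSTower_congruenceTower, fun j => ⟨j + 2, fun g hg => ?_⟩⟩
  exact ⟨⟨g, congruenceSubgroup_anti ⟨2 ^ j, by ring⟩ hg⟩, hg, rfl⟩
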